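/- Let $\Gamma$ be a countable discrete group with identity $e$, and let $\mu$ be a probability measure on $\Gamma$. Write $\mu^{(n)}$ for the $n$-th convolution power of $\mu$, so that the random walk on $\Gamma$ with law $\mu$ has $n$-step transition probabilities $p^{(n)}(x,y)=\mu^{(n)}(x^{-1}y)$. Assume that $\mu$ is irreducible, i.e. for all $x,y\in\Gamma$ there is $n\ge 1$ with $\mu^{(n)}(x^{-1}y)>0$, and aperiodic, i.e. $\gcd\{n\ge 1:\mu^{(n)}(e)>0\}=1$. Then the number $$\rho(\mu)=\limsup_{n\to\infty}\mu^{(n)}(x)^{1/n}$$ (the spectral radius of $\mu$) does not depend on $x\in\Gamma$, and for every $x\in\Gamma$ one has $\mu^{(n)}(x)>0$ for all sufficiently large $n$ and $$\lim_{n\to\infty}\frac{\mu^{(n+1)}(x)}{\mu^{(n)}(x)}=\rho(\mu).$$ -/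

import Mathlib

open MeasureTheory Filter Topology

namespace GroupWalk

variable {Γ : Type*} [Group Γ] [MeasurableSpace Γ]

/-- The `n`-th convolution power `μ^(n)` of a measure on a group; `μ^(0)` is the unit mass
at the identity. -/
noncomputable def convPow (μ : Measure Γ) : ℕ → Measure Γ
  | 0 => Measure.dirac 1
  | n + 1 => Measure.mconv (convPow μ n) μ

/-- The number `μ^(n)(x)`, i.e. the mass of the point `x` under the `n`-th convolution power. -/
noncomputable def mass (μ : Measure Γ) (n : ℕ) (x : Γ) : ℝ := (convPow μ n).real {x}

/-- The `n`-step transition probability `p^(n)(x, y) = μ^(n)(x⁻¹ y)` of the random walk with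
law `μ`. -/
noncomputable def transition (μ : Measure Γ) (n : ℕ) (x y : Γ) : ℝ := mass μ n (x⁻¹ * y)

/-- Irreducibility of the random walk with law `μ` as a Markov chain. -/
def IsIrreducible (μ : Measure Γ) : Prop :=
  ∀ x y : Γ, ∃ n : ℕ, 1 ≤ n ∧ 0 < transition μ n x y

/-- The period `d(μ) = gcd {n ≥ 1 : μ^(n)(e) > 0}`. -/
noncomputable def period (μ : Measure Γ) : ℕ :=
  Nat.setGcd {n : ℕ | 1 ≤ n ∧ 0 < mass μ n 1}

/-- Aperiodicity: the period is `1`. -/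
def IsAperiodic (μ : Measure Γ) : Prop := period μ = 1

/-- `limsup_n μ^(n)(x)^(1/n)`, computed at the point `x`. -/
noncomputable def rootLimsup (μ : Measure Γ) (x : Γ) : ℝ :=
  limsup (fun n : ℕ => mass μ n x ^ (1 / (n : ℝ))) atTop

/-- The spectral radius `ρ(μ) = limsup_n μ^(n)(e)^(1/n)`. -/
noncomputable def specRadius (μ : Measure Γ) : ℝ := rootLimsup μ 1

end GroupWalk

/-! Choose `m` with `α = μ^(m)(e) > 0` and write `μ^(m) = α δ_e + σ`. Expanding powers of this sum
makes the masses `p n = μ^(mn+j)(x)` binomial averages, and Cauchy–Schwarz for the moments of the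
binomial index (`binomial_array_sq_le`) shows that `(n + 1) * p n / p (n + 1)` grows by at most
`1/α` per step. The ratios `p n / p (n + 1)` thus cannot rise quickly. Supermultiplicativity and
Fekete's lemma give one exponential rate `l` at all points (`exists_tendsto_log_mass_div`). Slow
growth upgrades this average rate to convergence of ratios (`tendsto_ratio_of_sq_le`). Aperiodicity
admits two consecutive values of `m`; dividing the two limits gives the one-step limit. -/

/-! ### Binomial arrays -/

/-- Evaluation of an array obeying `b (n + 1) k = α * b n k + b n (k + 1)` on its left edge. -/
lemma binomial_array_eq_sum {α : ℝ} {b : ℕ → ℕ → ℝ}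
    (hb : ∀ n k, b (n + 1) k = α * b n k + b n (k + 1)) (n k : ℕ) :
    b n k = ∑ i ∈ Finset.range (n + 1), (n.choose i : ℝ) * (α ^ i * b 0 (k + (n - i))) := by
  -- Each row is `α + S` applied to the previous one, with `S` the shift; scalars commute with `S`,
  -- so the binomial theorem applies.
  let S : Module.End ℝ (ℕ → ℝ) :=
    { toFun := fun f k => f (k + 1), map_add' := fun _ _ => rfl, map_smul' := fun _ _ => rfl }
  have hS : ∀ j (f : ℕ → ℝ) k, (S ^ j) f k = f (k + j) := by
    intro j
    induction j with
    | zero => intro f k; simp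
    | succ j ih =>
      intro f k
      rw [pow_succ, Module.End.mul_apply, ih]
      change f (k + j + 1) = _
      rw [add_assoc]
  have hbn : ∀ n, b n = ((algebraMap ℝ (Module.End ℝ (ℕ → ℝ)) α + S) ^ n) (b 0) := by
    intro n
    induction n with
    | zero => simp
    | succ n ih =>
      rw [pow_succ', Module.End.mul_apply, ← ih]
      funext k
      rw [hb]
      rfl
  rw [hbn, Commute.add_pow (Algebra.commutes α S), LinearMap.sum_apply, Finset.sum_apply]
  refine Finset.sum_congr rfl fun i _ => ?_
  rw [← map_pow, ← Nat.cast_comm, ← nsmul_eq_mul, LinearMap.smul_apply, Module.End.mul_apply]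
  simp [hS, Module.algebraMap_end_apply, nsmul_eq_mul, -map_pow]

/-- Absorption, `i * C(n+1, i) = (n+1) * C(n, i-1)`; it evaluates the first and second moments of
the binomial index. -/
lemma sum_id_mul_choose (n : ℕ) (g : ℕ → ℝ) :
    ∑ i ∈ Finset.range (n + 2), ((n + 1).choose i : ℝ) * (i * g i) =
      (n + 1) * ∑ i ∈ Finset.range (n + 1), (n.choose i : ℝ) * g (i + 1) := by
  rw [Finset.sum_range_succ', Finset.mul_sum]
  simp only [Nat.cast_zero, zero_mul, mul_zero, add_zero]
  refine Finset.sum_congr rfl fun i _ => ?_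
  have h : ((n : ℝ) + 1) * n.choose i = (n + 1).choose (i + 1) * (i + 1) := by
    exact_mod_cast Nat.add_one_mul_choose_eq n i
  push_cast
  rw [← mul_assoc, ← mul_assoc, h]

/-- A quadratic inequality for the left edge of a nonnegative binomial array: the Cauchy–Schwarz
inequality for the weights of the binomial expansion. -/
lemma binomial_array_sq_le {α : ℝ} (hα : 0 < α) {b : ℕ → ℕ → ℝ} (hb0 : ∀ n k, 0 ≤ b n k)
    (hb : ∀ n k, b (n + 1) k = α * b n k + b n (k + 1)) (n : ℕ) :
    (n + 2) * α * b (n + 1) 0 ^ 2 ≤ b (n + 2) 0 * ((n + 1) * α * b n 0 + b (n + 1) 0) := by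
  have key := fun n => binomial_array_eq_sum hb n 0
  simp only [zero_add] at key
  -- Shifting `g` by 0, 1, 2 recovers rows `n + 2`, `n + 1`, `n`, up to the factors 1, `α`, `α ^ 2`.
  set g : ℕ → ℝ := fun i => α ^ i * b 0 (n + 2 - i) with hg
  have e2 : ∑ i ∈ Finset.range (n + 3), ((n + 2).choose i : ℝ) * g i = b (n + 2) 0 :=
    (key (n + 2)).symm
  have e1 : ∑ i ∈ Finset.range (n + 2), ((n + 1).choose i : ℝ) * g (i + 1)
      = α * b (n + 1) 0 := by
    rw [key (n + 1), Finset.mul_sum]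
    refine Finset.sum_congr rfl fun i _ => ?_
    simp only [hg, show n + 2 - (i + 1) = n + 1 - i by omega]
    ring
  have e0 : ∑ i ∈ Finset.range (n + 1), (n.choose i : ℝ) * g (i + 2) = α ^ 2 * b n 0 := by
    rw [key n, Finset.mul_sum]
    refine Finset.sum_congr rfl fun i _ => ?_
    simp only [hg, show n + 2 - (i + 2) = n - i by omega]
    ring
  have m1 := sum_id_mul_choose (n + 1) g
  have m2 := sum_id_mul_choose (n + 1) fun i => i * g i
  have m3 := sum_id_mul_choose n fun i => g (i + 1)
  have m4 : ∑ i ∈ Finset.range (n + 2), ((n + 1).choose i : ℝ) * (((i + 1 : ℕ) : ℝ) * g (i + 1))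
      = (n + 1) * (α ^ 2 * b n 0) + α * b (n + 1) 0 := by
    rw [← e0, ← e1, ← m3, ← Finset.sum_add_distrib]
    refine Finset.sum_congr rfl fun i _ => ?_
    push_cast
    ring
  rw [e1] at m1
  rw [m4] at m2
  -- The squared first moment of `i` under the weights `C(n+2, i) * g i` is at most total mass times
  -- second moment.
  have cs := Finset.sum_sq_le_sum_mul_sum_of_sq_le_mul (Finset.range (n + 3))
    (r := fun i => ((n + 2).choose i : ℝ) * (i * g i))
    (f := fun i => ((n + 2).choose i : ℝ) * g i)
    (g := fun i => ((n + 2).choose i : ℝ) * (i * (i * g i)))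
    (fun i _ => by have := hb0 0 (n + 2 - i); positivity)
    (fun i _ => by have := hb0 0 (n + 2 - i); positivity)
    (fun i _ => le_of_eq (by ring))
  rw [show n + 1 + 2 = n + 3 from rfl, show n + 1 + 1 = n + 2 from rfl] at m1 m2
  rw [e2, m1, m2] at cs
  have hpos : 0 < ((n : ℝ) + 2) * α := by positivity
  push_cast at cs
  refine le_of_mul_le_mul_left ?_ hpos
  nlinarith [cs]

/-! ### A Tauberian theorem -/

/-- If `L n / n → l`, then increments of `L` over windows of length comparable to `n` have
average slope close to `l`. -/
lemma abs_sub_sub_le_of_tendsto_div {L : ℕ → ℝ} {l : ℝ}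
    (hL : Tendsto (fun n : ℕ => L n / n) atTop (𝓝 l)) (d : ℕ) {ε : ℝ} (hε : 0 < ε) :
    ∃ N, ∀ n ≥ N, ∀ k, n ≤ d * k → |L (n + k) - L n - l * k| ≤ ε * k := by
  -- The errors at `n` and `n + k` add up to `η * (2n + k)`, at most `η * (2d + 1) * k`.
  set η : ℝ := ε / (2 * d + 1) with hη
  have hη0 : 0 < η := by positivity
  obtain ⟨N, hN⟩ := eventually_atTop.1 (Metric.tendsto_nhds.1 hL η hη0)
  have hN' : ∀ n ≥ N + 1, |L n - l * n| ≤ η * n := by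
    intro n hn
    have hn0 : (0 : ℝ) < n := by exact_mod_cast (by omega : 0 < n)
    have h := hN n (by omega)
    rw [Real.dist_eq] at h
    have e : L n - l * n = (L n / n - l) * n := by field_simp
    rw [e, abs_mul, abs_of_pos hn0]
    exact mul_le_mul_of_nonneg_right h.le hn0.le
  refine ⟨N + 1, fun n hn k hk => ?_⟩
  have h1 := abs_le.1 (hN' n hn)
  have h2 := abs_le.1 (hN' (n + k) (by omega))
  have hk' : (n : ℝ) ≤ d * k := by exact_mod_cast hk
  have h3 : η * n + η * (n + k) ≤ ε * k := by
    have : ε = η * (2 * d + 1) := by rw [hη]; field_simp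
    rw [this]
    nlinarith
  push_cast at h2
  rw [abs_le]
  constructor <;> nlinarith

/-- A Tauberian theorem: a positive sequence with `log (p n) / n → l` whose consecutive ratios
`p n / p (n + 1)` grow slowly has convergent ratios. -/
lemma tendsto_ratio_of_sq_le {α : ℝ} (hα : 0 < α) {p : ℕ → ℝ} (hp : ∀ᶠ n in atTop, 0 < p n)
    (hsq : ∀ n : ℕ, (n + 2) * α * p (n + 1) ^ 2 ≤ p (n + 2) * ((n + 1) * α * p n + p (n + 1)))
    {l : ℝ} (hl : Tendsto (fun n : ℕ => Real.log (p n) / n) atTop (𝓝 l)) :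
    Tendsto (fun n => p (n + 1) / p n) atTop (𝓝 (Real.exp l)) := by
  obtain ⟨N₀, hN₀⟩ := eventually_atTop.1 hp
  set r : ℕ → ℝ := fun n => p n / p (n + 1) with hr
  have rpos : ∀ n ≥ N₀, 0 < r n := fun n hn => div_pos (hN₀ n hn) (hN₀ _ (by omega))
  have step : ∀ n ≥ N₀, ((n : ℝ) + 2) * r (n + 1) ≤ (n + 1) * r n + 1 / α := by
    intro n hn
    have h0 := hN₀ n hn
    have h1 := hN₀ (n + 1) (by omega)
    have h2 := hN₀ (n + 2) (by omega)
    have e : (n + 1) * r n + 1 / α - ((n : ℝ) + 2) * r (n + 1) =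
        (p (n + 2) * ((n + 1) * α * p n + p (n + 1)) - (n + 2) * α * p (n + 1) ^ 2)
          / (α * p (n + 1) * p (n + 2)) := by
      simp only [hr]
      field_simp
    have : 0 ≤ (n + 1) * r n + 1 / α - ((n : ℝ) + 2) * r (n + 1) := by
      rw [e]
      exact div_nonneg (sub_nonneg.2 (hsq n)) (by positivity)
    linarith
  have steps : ∀ n ≥ N₀, ∀ k : ℕ, ((n : ℝ) + k + 1) * r (n + k) ≤ (n + 1) * r n + k / α := by
    intro n hn k
    induction k with
    | zero => simp
    | succ k ih =>
      have := step (n + k) (by omega)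
      rw [← add_assoc n k 1]
      push_cast at this ⊢
      rw [add_div]
      have e : (n : ℝ) + (k + 1) + 1 = n + k + 2 := by ring
      rw [e]
      linarith
  -- A one-sided bound: `r` may drop abruptly but can only rise slowly.
  have slow : ∀ n ≥ N₀, ∀ k : ℕ, r (n + k) ≤ r n + k / α / (n + 1) := by
    intro n hn k
    have h := steps n hn k
    have hk : ((n : ℝ) + 1) * r (n + k) ≤ (n + k + 1) * r (n + k) := by
      apply mul_le_mul_of_nonneg_right _ (rpos _ (by omega)).le
      have : (0 : ℝ) ≤ k := by positivity
      linarith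
    have hn1 : (0 : ℝ) < n + 1 := by positivity
    rw [← sub_le_iff_le_add', le_div_iff₀ hn1]
    nlinarith
  have tele : ∀ n ≥ N₀, ∀ k, Real.log (p n) - Real.log (p (n + k)) =
      ∑ i ∈ Finset.range k, Real.log (r (n + i)) := by
    intro n hn k
    induction k with
    | zero => simp
    | succ k ih =>
      rw [Finset.sum_range_succ, ← ih]
      simp only [hr]
      rw [Real.log_div (hN₀ _ (by omega)).ne' (hN₀ _ (by omega)).ne', add_assoc]
      ring
  have upper : ∀ n ≥ N₀, ∀ k ≥ 1, ∀ c, 0 < c → (∀ i < k, r (n + i) ≤ c) →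
      ∀ ε, |Real.log (p (n + k)) - Real.log (p n) - l * k| ≤ ε * k → Real.exp (-l - ε) ≤ c := by
    intro n hn k hk c hc h ε hε
    have hk0 : (0 : ℝ) < k := by exact_mod_cast hk
    have h1 : ∑ i ∈ Finset.range k, Real.log (r (n + i)) ≤ k * Real.log c := by
      rw [← nsmul_eq_mul, ← Finset.card_range k, ← Finset.sum_const, Finset.card_range]
      exact Finset.sum_le_sum fun i hi =>
        Real.log_le_log (rpos _ (by omega)) (h i (Finset.mem_range.1 hi))
    rw [← tele n hn] at h1
    have h2 := abs_le.1 hε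
    rw [← Real.le_log_iff_exp_le hc]
    refine le_of_mul_le_mul_left ?_ hk0
    nlinarith
  have lower : ∀ n ≥ N₀, ∀ k ≥ 1, ∀ c, (∀ i < k, c ≤ r (n + i)) →
      ∀ ε, |Real.log (p (n + k)) - Real.log (p n) - l * k| ≤ ε * k → c ≤ Real.exp (-l + ε) := by
    intro n hn k hk c h ε hε
    rcases le_or_gt c 0 with hc | hc
    · exact hc.trans (Real.exp_pos _).le
    have hk0 : (0 : ℝ) < k := by exact_mod_cast hk
    have h1 : k * Real.log c ≤ ∑ i ∈ Finset.range k, Real.log (r (n + i)) := by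
      rw [← nsmul_eq_mul, ← Finset.card_range k, ← Finset.sum_const, Finset.card_range]
      exact Finset.sum_le_sum fun i hi => Real.log_le_log hc (h i (Finset.mem_range.1 hi))
    rw [← tele n hn] at h1
    have h2 := abs_le.1 hε
    rw [← Real.log_le_iff_le_exp hc]
    refine le_of_mul_le_mul_left ?_ hk0
    nlinarith
  have hlim : Tendsto r atTop (𝓝 (Real.exp (-l))) := by
    have cont : ∀ s t : ℝ, Tendsto (fun d : ℕ => Real.exp (-l + s * (1 / d)) + t * (1 / d))
        atTop (𝓝 (Real.exp (-l))) := by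
      intro s t
      have h1 : Tendsto (fun d : ℕ => (1 : ℝ) / d) atTop (𝓝 0) :=
        tendsto_one_div_atTop_nhds_zero_nat
      have h2 := ((Real.continuous_exp.tendsto _).comp
        (tendsto_const_nhds.add (h1.const_mul s) : Tendsto _ _ (𝓝 (-l + s * 0)))).add
          (h1.const_mul t)
      simpa only [mul_zero, add_zero, Function.comp_def] using h2
    refine tendsto_order.2 ⟨fun x hx => ?_, fun x hx => ?_⟩
    -- If `r n` were small, `r` would stay small on the window of length `n / d` after `n`, against
    -- its geometric mean there being close to `exp (-l)`.
    · obtain ⟨d, hdx, hd⟩ := (((cont (-1) (-(1 / α))).eventually (lt_mem_nhds hx)).and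
        (eventually_ge_atTop 1)).exists
      have hd0 : (0 : ℝ) < d := by exact_mod_cast hd
      obtain ⟨N, hN⟩ := abs_sub_sub_le_of_tendsto_div hl (2 * d) (one_div_pos.2 hd0)
      filter_upwards [eventually_ge_atTop N, eventually_ge_atTop N₀, eventually_ge_atTop d]
        with n h1 h2 h3
      set k := n / d with hk
      have hk1 : 1 ≤ k := (Nat.one_le_div_iff (by omega)).2 h3
      have hkd : k * d ≤ n := Nat.div_mul_le_self n d
      have hnd : n < d * k + d := Nat.lt_mul_div_succ n (by omega)
      have hdk : d ≤ d * k := Nat.le_mul_of_pos_right d hk1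
      have hw := hN n h1 k (by rw [mul_assoc]; omega)
      have hbd : ∀ i < k, r (n + i) ≤ r n + 1 / α * (1 / d) := by
        intro i hi
        refine (slow n h2 i).trans (add_le_add_right ?_ _)
        have hid : (i : ℝ) * d ≤ n :=
          le_trans (by gcongr) (show (k : ℝ) * d ≤ n by exact_mod_cast hkd)
        rw [div_div, one_div_mul_one_div, div_le_div_iff₀ (by positivity) (by positivity)]
        nlinarith
      have := upper n h2 k hk1 _ (add_pos (rpos n h2) (by positivity)) hbd _ hw
      rw [show -l + -1 * (1 / (d : ℝ)) = -l - 1 / d by ring] at hdx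
      linarith
    -- If `r m` were large, `r` would already be large on the window before `m`. The divisor `d + 1`
    -- ensures `k * d ≤ n` at the window's start `n = m - k`.
    · obtain ⟨d, hdx, hd⟩ := (((cont 1 (1 / α)).eventually (gt_mem_nhds hx)).and
        (eventually_ge_atTop 1)).exists
      have hd0 : (0 : ℝ) < d := by exact_mod_cast hd
      obtain ⟨N, hN⟩ := abs_sub_sub_le_of_tendsto_div hl (2 * (d + 1)) (one_div_pos.2 hd0)
      filter_upwards [eventually_ge_atTop (2 * N), eventually_ge_atTop (2 * N₀),
        eventually_ge_atTop (d + 1)] with m h1 h2 h3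
      set k := m / (d + 1) with hk
      have hk1 : 1 ≤ k := (Nat.one_le_div_iff (by omega)).2 h3
      have hkd : k * (d + 1) ≤ m := Nat.div_mul_le_self m (d + 1)
      have hnd : m < (d + 1) * k + (d + 1) := Nat.lt_mul_div_succ m (by omega)
      have hdk : d + 1 ≤ (d + 1) * k := Nat.le_mul_of_pos_right (d + 1) hk1
      have hk2 : k * 2 ≤ k * (d + 1) := Nat.mul_le_mul_left k (by omega)
      clear_value k
      obtain ⟨n, rfl⟩ : ∃ n, m = n + k := ⟨m - k, by omega⟩
      have hkn : k * d ≤ n := by rw [mul_add] at hkd; omega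
      have hw := hN n (by omega) k (by rw [mul_assoc]; omega)
      have hbd : ∀ i < k, r (n + k) - 1 / α * (1 / d) ≤ r (n + i) := by
        intro i hi
        have h := slow (n + i) (by omega) (k - i)
        rw [show n + i + (k - i) = n + k by omega] at h
        have hid : ((k - i : ℕ) : ℝ) * d ≤ n :=
          le_trans (by gcongr; omega) (show (k : ℝ) * d ≤ n by exact_mod_cast hkn)
        have : ((k - i : ℕ) : ℝ) / α / ((n + i : ℕ) + 1) ≤ 1 / α * (1 / d) := by
          rw [div_div, one_div_mul_one_div, div_le_div_iff₀ (by positivity) (by positivity)]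
          have : (0 : ℝ) ≤ i := by positivity
          push_cast
          nlinarith
        linarith
      have := lower n (by omega) k hk1 _ hbd _ hw
      rw [one_mul] at hdx
      linarith
  have := hlim.inv₀ (Real.exp_pos _).ne'
  rw [← Real.exp_neg, neg_neg] at this
  refine this.congr fun n => ?_
  simp [hr]

/-! ### Masses of convolution powers -/

namespace GroupWalk

lemma mass_nonneg {Γ : Type*} [Group Γ] [MeasurableSpace Γ] (μ : Measure Γ) (n : ℕ) (x : Γ) :
    0 ≤ mass μ n x := measureReal_nonneg

section

variable {Γ : Type*} [Group Γ] [Countable Γ] [MeasurableSpace Γ] [DiscreteMeasurableSpace Γ]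

lemma real_mul_real_le_mconv (ν₁ ν₂ : Measure Γ) [IsFiniteMeasure ν₁] [IsFiniteMeasure ν₂]
    (x y : Γ) : ν₁.real {x} * ν₂.real {y} ≤ (Measure.mconv ν₁ ν₂).real {x * y} := by
  rw [Measure.mconv, map_measureReal_apply (by fun_prop) (measurableSet_singleton _),
    ← measureReal_prod_prod]
  refine measureReal_mono ?_
  rintro ⟨a, b⟩ ⟨ha, hb⟩
  simp_all

instance sFinite_convPow (μ : Measure Γ) [SFinite μ] (n : ℕ) : SFinite (convPow μ n) := by
  induction n with
  | zero => unfold convPow; infer_instance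
  | succ n ih => unfold convPow; infer_instance

lemma convPow_add (μ : Measure Γ) [SFinite μ] (m n : ℕ) :
    convPow μ (m + n) = Measure.mconv (convPow μ m) (convPow μ n) := by
  induction n with
  | zero => exact (Measure.mconv_dirac_one _).symm
  | succ n ih =>
    rw [← add_assoc]
    simp only [convPow]
    rw [ih, Measure.mconv_assoc]

lemma mass_zero_one (μ : Measure Γ) : mass μ 0 1 = 1 := by
  simp [mass, convPow, Measure.real]

instance isProbabilityMeasure_convPow (μ : Measure Γ) [IsProbabilityMeasure μ] (n : ℕ) :
    IsProbabilityMeasure (convPow μ n) := by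
  induction n with
  | zero => unfold convPow; infer_instance
  | succ n ih => unfold convPow; infer_instance

variable (μ : Measure Γ) [IsProbabilityMeasure μ]

lemma mass_le_one (n : ℕ) (x : Γ) : mass μ n x ≤ 1 := measureReal_le_one

lemma mass_mul_mass_le (m n : ℕ) (x y : Γ) :
    mass μ m x * mass μ n y ≤ mass μ (m + n) (x * y) := by
  simp only [mass, convPow_add]
  exact real_mul_real_le_mconv _ _ x y

/-- The masses along an arithmetic progression are the left edge of a binomial array, obtained by
splitting `μ^(m)` into its atom at `1` and the rest. -/
lemma exists_binomial_array (m j : ℕ) (x : Γ) :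
    ∃ b : ℕ → ℕ → ℝ, (∀ n k, 0 ≤ b n k) ∧
      (∀ n k, b (n + 1) k = mass μ m 1 * b n k + b n (k + 1)) ∧
      ∀ n, b n 0 = mass μ (m * n + j) x := by
  set σ : Measure Γ := (convPow μ m).restrict {1}ᶜ with hσ
  have hsplit : convPow μ m = (convPow μ m) {1} • Measure.dirac 1 + σ := by
    rw [← Measure.restrict_singleton, hσ,
      Measure.restrict_add_restrict_compl (measurableSet_singleton _)]
  -- Left convolution by `σ`, `k` times: the column index `k` counts factors of `σ`.
  set T : ℕ → Measure Γ → Measure Γ := fun k => (fun ν => Measure.mconv σ ν)^[k] with hT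
  have T_finite : ∀ k (ν : Measure Γ) [IsFiniteMeasure ν], IsFiniteMeasure (T k ν) := by
    intro k
    induction k with
    | zero => intro ν h; exact h
    | succ k ih =>
      intro ν h
      exact ih (Measure.mconv σ ν)
  have T_add : ∀ k (c : ENNReal) (ν ν' : Measure Γ) [SFinite ν] [SFinite ν'],
      T k (c • ν + ν') = c • T k ν + T k ν' := by
    intro k
    induction k with
    | zero => intros; rfl
    | succ k ih =>
      intro c ν ν' _ _
      simp only [hT, Function.iterate_succ, Function.comp_apply] at ih ⊢
      rw [Measure.mconv_add, Measure.mconv_smul_right, ih]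
  refine ⟨fun n k => (T k (convPow μ (m * n + j))).real {x}, fun _ _ => measureReal_nonneg,
    fun n k => ?_, fun n => rfl⟩
  have e : convPow μ (m * (n + 1) + j) = (convPow μ m) {1} • convPow μ (m * n + j)
      + Measure.mconv σ (convPow μ (m * n + j)) := by
    rw [show m * (n + 1) + j = m + (m * n + j) by ring, convPow_add μ m]
    conv_lhs => rw [hsplit]
    rw [Measure.add_mconv, Measure.mconv_smul_left, Measure.dirac_one_mconv]
  have h1 := T_finite k (convPow μ (m * n + j))
  have h2 := T_finite k (Measure.mconv σ (convPow μ (m * n + j)))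
  have h3 : IsFiniteMeasure ((convPow μ m) {1} • T k (convPow μ (m * n + j))) :=
    Measure.smul_finite _ (measure_ne_top _ _)
  simp only [e]
  rw [T_add, measureReal_add_apply, measureReal_ennreal_smul_apply]
  rfl

variable {μ}

/-- The return times form an additive semigroup of gcd 1, hence contain all large integers. -/
lemma exists_forall_mass_one_pos (haper : IsAperiodic μ) : ∃ N, ∀ n ≥ N, 0 < mass μ n 1 := by
  obtain ⟨N, hN⟩ := Nat.exists_mem_closure_of_ge {n : ℕ | 1 ≤ n ∧ 0 < mass μ n 1}
  refine ⟨N, fun n hn => ?_⟩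
  have hmem := hN n hn (by rw [show Nat.setGcd _ = 1 from haper]; exact one_dvd n)
  clear hn
  induction hmem using AddSubmonoid.closure_induction with
  | mem k hk => exact hk.2
  | zero => rw [mass_zero_one]; exact one_pos
  | add a b _ _ ha hb =>
    simpa using (mul_pos ha hb).trans_le (mass_mul_mass_le μ a b 1 1)

lemma eventually_mass_pos (hirr : IsIrreducible μ) (haper : IsAperiodic μ) (x : Γ) :
    ∀ᶠ n in atTop, 0 < mass μ n x := by
  obtain ⟨N, hN⟩ := exists_forall_mass_one_pos haper
  obtain ⟨k, -, hk⟩ := hirr 1 x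
  rw [transition, inv_one, one_mul] at hk
  filter_upwards [eventually_ge_atTop (N + k)] with n hn
  have := (mul_pos (hN (n - k) (by omega)) hk).trans_le (mass_mul_mass_le μ (n - k) k 1 x)
  rwa [one_mul, Nat.sub_add_cancel (by omega)] at this

/-! ### Exponential rate and ratio limits -/

/-- All `n`-step return and hitting probabilities have the same exponential rate. -/
lemma exists_tendsto_log_mass_div (hirr : IsIrreducible μ) (haper : IsAperiodic μ) :
    ∃ l : ℝ, ∀ x : Γ, Tendsto (fun n : ℕ => Real.log (mass μ n x) / n) atTop (𝓝 l) := by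
  obtain ⟨N, hN⟩ := exists_forall_mass_one_pos haper
  set m := N + 1 with hm
  have hm0 : (0 : ℝ) < m := by positivity
  have hpos : ∀ q, 0 < mass μ (m * q) 1 := by
    intro q
    rcases Nat.eq_zero_or_pos q with rfl | hq
    · rw [mul_zero, mass_zero_one]; exact one_pos
    · exact hN _ ((Nat.le_succ N).trans (Nat.le_mul_of_pos_right m hq))
  have hsub : Subadditive fun q => -Real.log (mass μ (m * q) 1) := by
    intro a b
    have h := Real.log_le_log (mul_pos (hpos a) (hpos b)) (mass_mul_mass_le μ _ _ 1 1)
    rw [Real.log_mul (hpos a).ne' (hpos b).ne', ← mul_add, mul_one] at h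
    linarith
  have hbdd : BddBelow (Set.range fun q : ℕ => -Real.log (mass μ (m * q) 1) / q) := by
    refine ⟨0, ?_⟩
    rintro _ ⟨q, rfl⟩
    exact div_nonneg (neg_nonneg.2 (Real.log_nonpos (mass_nonneg ..) (mass_le_one ..)))
      q.cast_nonneg
  have hF := (hsub.tendsto_lim hbdd).neg
  simp only [← neg_div, neg_neg] at hF
  set L := -hsub.lim
  refine ⟨L / m, fun x => ?_⟩
  obtain ⟨M, hM⟩ := eventually_atTop.1 (eventually_mass_pos hirr haper x)
  obtain ⟨M', hM'⟩ := eventually_atTop.1 (eventually_mass_pos hirr haper x⁻¹)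
  -- Bounded shifts of index, numerator and denominator do not affect the rate.
  have hdiv : ∀ (c : ℕ) (C r : ℝ), Tendsto (fun q : ℕ =>
      (Real.log (mass μ (m * (q + c)) 1) + C) / (m * q + r)) atTop (𝓝 (L / m)) := by
    intro c C r
    have t : ∀ C : ℝ, Tendsto (fun q : ℕ => C / (q : ℝ)) atTop (𝓝 0) :=
      tendsto_const_div_atTop_nhds_zero_nat
    have h := (((hF.comp (tendsto_add_atTop_nat c)).mul ((t c).const_add 1)).add (t C)).div
      ((t r).const_add (m : ℝ)) (by rw [add_zero]; exact hm0.ne')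
    simp only [add_zero, mul_one] at h
    refine h.congr' ?_
    filter_upwards [eventually_gt_atTop 0] with q hq
    have hq0 : (0 : ℝ) < q := by exact_mod_cast hq
    have hqc : ((q + c : ℕ) : ℝ) ≠ 0 := by positivity
    have e1 : 1 + (c : ℝ) / q = (q + c : ℕ) / q := by push_cast; field_simp
    have e2 : (m : ℝ) + r / q = (m * q + r) / q := by field_simp
    simp only [Pi.div_apply, Function.comp_apply]
    rw [e1, e2, div_mul_div_cancel₀ hqc, ← add_div, div_div_div_cancel_right₀ hq0.ne']
  have hres : ∀ r, Tendsto (fun q : ℕ => Real.log (mass μ (m * q + r) x) / (m * q + r : ℕ)) atTop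
      (𝓝 (L / m)) := by
    intro r
    have hMm : M ≤ m * M := Nat.le_mul_of_pos_left M (Nat.succ_pos N)
    -- The upper bound goes to `x` and then back to `1` in `s` steps; `s` makes the total time a
    -- multiple of `m`. The lower bound returns to `1` and then goes to `x`.
    obtain ⟨s, hs, hsM⟩ : ∃ s, r + s = m * (M' + r) ∧ M' ≤ s := by
      have h1 : M' ≤ m * M' := Nat.le_mul_of_pos_left M' (Nat.succ_pos N)
      have h2 : r ≤ m * r := Nat.le_mul_of_pos_left r (Nat.succ_pos N)
      rw [mul_add]
      exact ⟨m * M' + (m * r - r), by omega, by omega⟩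
    have hposr := hM (m * M + r) (by omega)
    have hposs := hM' s hsM
    rw [← tendsto_add_atTop_iff_nat M]
    refine tendsto_of_tendsto_of_tendsto_of_le_of_le
      (hdiv 0 (Real.log (mass μ (m * M + r) x)) ((m * M + r : ℕ) : ℝ))
      (hdiv (M + (M' + r)) (-Real.log (mass μ s x⁻¹)) ((m * M + r : ℕ) : ℝ)) (fun q => ?_)
      (fun q => ?_)
    all_goals
      have e : ((m * (q + M) + r : ℕ) : ℝ) = m * q + (m * M + r : ℕ) := by push_cast; ring
      have hposq := hM (m * (q + M) + r) (by rw [mul_add]; omega)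
      simp only [e]
      refine div_le_div_of_nonneg_right ?_ (by positivity)
    · have h := Real.log_le_log (mul_pos (hpos q) hposr) (mass_mul_mass_le μ _ _ 1 x)
      rw [Real.log_mul (hpos q).ne' hposr.ne', one_mul, ← add_assoc, ← mul_add] at h
      simpa using h
    · have h := Real.log_le_log (mul_pos hposq hposs) (mass_mul_mass_le μ _ _ x x⁻¹)
      rw [Real.log_mul hposq.ne' hposs.ne', mul_inv_cancel, add_assoc, hs, ← mul_add,
        add_assoc] at h
      linarith
  intro s hs
  exact Eventually.atTop_of_arithmetic (n := m) (by omega) fun r _ => hres r hs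

/-- The ratio limit theorem along steps of a length `m` for which `μ^(m)(1) > 0`. -/
lemma tendsto_mass_add_div (hirr : IsIrreducible μ) (haper : IsAperiodic μ) {l : ℝ} (x : Γ)
    (hl : Tendsto (fun n : ℕ => Real.log (mass μ n x) / n) atTop (𝓝 l)) {m : ℕ} (hm : m ≠ 0)
    (hm1 : 0 < mass μ m 1) :
    Tendsto (fun n => mass μ (n + m) x / mass μ n x) atTop (𝓝 (Real.exp l ^ m)) := by
  have hpos := eventually_mass_pos hirr haper x
  have hprog : ∀ j, Tendsto (fun n => m * n + j) atTop atTop := fun j =>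
    tendsto_atTop_mono
      (fun n => (Nat.le_mul_of_pos_left n (Nat.pos_of_ne_zero hm)).trans (Nat.le_add_right _ j))
      tendsto_id
  have hres : ∀ j, Tendsto (fun n => mass μ (m * n + j + m) x / mass μ (m * n + j) x) atTop
      (𝓝 (Real.exp l ^ m)) := by
    intro j
    obtain ⟨b, hb0, hb, hbm⟩ := exists_binomial_array μ m j x
    have hsq := binomial_array_sq_le hm1 hb0 hb
    -- One step of `n` is `m` steps of the walk, so the rate is multiplied by `m`.
    have hlj : Tendsto (fun n : ℕ => Real.log (b n 0) / n) atTop (𝓝 (l * m)) := by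
      have h1 := hl.comp (hprog j)
      have h2 : Tendsto (fun n : ℕ => (m : ℝ) + j / n) atTop (𝓝 m) := by
        simpa using tendsto_const_nhds.add (tendsto_const_div_atTop_nhds_zero_nat (j : ℝ))
      refine (h1.mul h2).congr' ?_
      filter_upwards [eventually_gt_atTop 0] with n hn
      have hn0 : (n : ℝ) ≠ 0 := by exact_mod_cast hn.ne'
      have hmn : ((m * n + j : ℕ) : ℝ) ≠ 0 := by
        exact_mod_cast (by have := Nat.mul_pos (Nat.pos_of_ne_zero hm) hn; omega : m * n + j ≠ 0)
      rw [hbm]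
      simp only [Function.comp]
      have : (m : ℝ) + j / n = (m * n + j : ℕ) / n := by push_cast; field_simp
      rw [this, div_mul_div_cancel₀ hmn]
    have h := tendsto_ratio_of_sq_le hm1 (p := fun n => b n 0)
      (by simp only [hbm]; exact (hprog j).eventually hpos) hsq hlj
    rw [mul_comm, Real.exp_nat_mul] at h
    refine h.congr fun n => ?_
    rw [hbm, hbm, show m * (n + 1) + j = m * n + j + m by ring]
  intro s hs
  exact Eventually.atTop_of_arithmetic hm fun j _ => hres j hs

end

end GroupWalk

/-- The first conjunct says that the spectral radius, defined at the identity, may be computed at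
any point of the group. In the second, the denominators are positive from some `n` on. -/
theorem theorem1 {Γ : Type*} [Group Γ] [Countable Γ] [MeasurableSpace Γ]
    [DiscreteMeasurableSpace Γ] (μ : Measure Γ) [IsProbabilityMeasure μ]
    (hirr : GroupWalk.IsIrreducible μ) (haper : GroupWalk.IsAperiodic μ) :
    (∀ x : Γ, GroupWalk.rootLimsup μ x = GroupWalk.specRadius μ) ∧
    ∀ x : Γ, (∀ᶠ n : ℕ in atTop, 0 < GroupWalk.mass μ n x) ∧
      Tendsto (fun n : ℕ => GroupWalk.mass μ (n + 1) x / GroupWalk.mass μ n x) atTop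
        (𝓝 (GroupWalk.specRadius μ)) := by
  obtain ⟨l, hl⟩ := GroupWalk.exists_tendsto_log_mass_div hirr haper
  have hroot : ∀ x : Γ, GroupWalk.rootLimsup μ x = Real.exp l := by
    intro x
    refine Tendsto.limsup_eq (((Real.continuous_exp.tendsto l).comp (hl x)).congr' ?_)
    filter_upwards [GroupWalk.eventually_mass_pos hirr haper x] with n hn
    rw [Real.rpow_def_of_pos hn, Function.comp_apply, mul_one_div]
  have hspec : GroupWalk.specRadius μ = Real.exp l := hroot 1
  refine ⟨fun x => (hroot x).trans hspec.symm, fun x => ?_⟩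
  have hpos := GroupWalk.eventually_mass_pos hirr haper x
  refine ⟨hpos, ?_⟩
  obtain ⟨N, hN⟩ := GroupWalk.exists_forall_mass_one_pos haper
  -- Step lengths `N + 1` and `N + 2` are both admissible; in the quotient of the two ratios `mass μ
  -- n x` cancels, leaving a one-step ratio at time `n + N + 1`.
  have h1 := GroupWalk.tendsto_mass_add_div hirr haper x (hl x) (Nat.succ_ne_zero N)
    (hN (N + 1) (by omega))
  have h2 := GroupWalk.tendsto_mass_add_div hirr haper x (hl x) (Nat.succ_ne_zero (N + 1))
    (hN (N + 2) (by omega))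
  have h := h2.div h1 (pow_pos (Real.exp_pos l) _).ne'
  rw [pow_succ (Real.exp l) (N + 1), mul_div_cancel_left₀ _ (pow_pos (Real.exp_pos l) _).ne',
    ← hspec] at h
  rw [← tendsto_add_atTop_iff_nat (N + 1)]
  refine h.congr' ?_
  filter_upwards [hpos] with n hn
  rw [Pi.div_apply, div_div_div_cancel_right₀ hn.ne']
  rfl
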